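/- \textbf{Theorem (upper bound).} Let $V_1,V_2,\dots$ and $W_1,W_2,\dots$ be two independent sequences of independent standard Gaussian (zero mean, unit variance) random variables, and fix $\varepsilon>0$, $s>0$, $l>0$. Let $X_0=Y_0=0$ and, for $t\ge 1$, $$X_t=\sum_{i=1}^t V_i+st,\qquad Y_t=X_t+\varepsilon\sum_{i=1}^t W_i,$$ and let $\tau_l=\inf\{t\ge 0: X_t\ge l\}$. Define $$\hat X_0=0,\qquad \hat X_t=st+\frac{1}{1+\varepsilon^2}(Y_t-st)\quad\text{for } t\ge 1,$$ and $\eta=\inf\{t\ge 0:\hat X_t\ge l\}$, where $t$ ranges over the integers and $\inf\emptyset=\infty$. Then $\eta$ is a stopping time with respect to the natural filtration of the process $Y$, both $\tau_l$ and $\eta$ are almost surely finite, $|\eta-\tau_l|$ is integrable, and $$\mathbb{E}|\eta-\tau_l|\le \sqrt{\frac{2l\varepsilon^2}{\pi(1+\varepsilon^2)s^3}}+\frac{6}{s}\left(\frac{l}{(2\pi s)^3}\right)^{1/4}+\sqrt{\frac{8(s+2)}{\pi s^3}}+10+\frac{20}{s}.$$ -/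

import Mathlib

open MeasureTheory ProbabilityTheory

noncomputable section

variable {Ω : Type*}

/-- The Gaussian random walk `X_0 = 0`, `X_t = s t + V_1 + ... + V_t`.
The increment `V_{i+1}` of the usual notation is `V i` here. -/
def walkX (s : ℝ) (V : ℕ → Ω → ℝ) (t : ℕ) (ω : Ω) : ℝ :=
  ∑ i ∈ Finset.range t, V i ω + s * t

/-- The observed walk `Y_0 = 0`, `Y_t = X_t + ε (W_1 + ... + W_t)`. -/
def walkY (ε s : ℝ) (V W : ℕ → Ω → ℝ) (t : ℕ) (ω : Ω) : ℝ :=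
  walkX s V t ω + ε * ∑ i ∈ Finset.range t, W i ω

/-- The estimate `s t + (Y_t - s t) / (1 + ε ^ 2)` of `X_t` (it is `0` at `t = 0`). -/
def walkXhat (ε s : ℝ) (V W : ℕ → Ω → ℝ) (t : ℕ) (ω : Ω) : ℝ :=
  s * t + 1 / (1 + ε ^ 2) * (walkY ε s V W t ω - s * t)

/-- The crossing time `inf {t ≥ 0 : Z_t ≥ l}`, equal to `⊤` if there is no such `t`. -/
def crossingTime (Z : ℕ → Ω → ℝ) (l : ℝ) : Ω → WithTop ℕ :=
  hittingAfter Z (Set.Ici l) 0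

/-- A time with values in `ℕ ∪ {∞}` as a real number; it is used only for times that are
almost surely finite. -/
def timeReal (a : WithTop ℕ) : ℝ := ((a.untopD 0 : ℕ) : ℝ)

theorem stronglyMeasurable_walkY [MeasurableSpace Ω] (ε s : ℝ) {V W : ℕ → Ω → ℝ}
    (hV : ∀ i, Measurable (V i)) (hW : ∀ i, Measurable (W i)) (t : ℕ) :
    StronglyMeasurable (walkY ε s V W t) := by
  apply Measurable.stronglyMeasurable
  unfold walkY walkX
  fun_prop

/-- The natural filtration of the observed walk. -/
def filtrationY [m : MeasurableSpace Ω] (ε s : ℝ) {V W : ℕ → Ω → ℝ}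
    (hV : ∀ i, Measurable (V i)) (hW : ∀ i, Measurable (W i)) : Filtration ℕ m :=
  Filtration.natural (walkY ε s V W) (stronglyMeasurable_walkY ε s hV hW)

end

/-! Both `walkX` and `walkXhat` are Gaussian walks with drift `s` and step variance at most one, and
the steps of their difference `D` are centred with variance `w = ε² / (1 + ε²)`. Write `A`, `B` for
the two walks in either order and `σ` for the crossing time of `B`. If `A` has not crossed by time
`σ`, its remaining distance to `l` is at most `D_σ`, since `B_σ ≥ l`. Optional stopping turns this
distance into time: `s` times the expected further delay is at most the expected positive part of
the distance plus the expected overshoot (`mul_sum_prob_compl_inter_staysBelow_le`). The overshoot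
costs at most `s + 1`, because a Gaussian step conditioned to exceed a positive level has bounded
mean excess (`integral_gaussian_excess_le`).

It remains to bound the mean of `(D_σ)⁺`. Compare `σ` with the deterministic time `N = ⌊l / s⌋`. The
variable `D_N` is exactly normal and gives the leading term. The correction `D_σ - D_N` is a
martingale transform whose second moment is `w` times the mean of `|σ - N|`, and that mean is of
order `√l` for large `l` (`sum_prob_discrepancy_le`); its square root gives the term in `l ^ (1/4)`.
All of this is done at a finite horizon `n`, uniformly in `n`, so no limit theorem for stopped
martingales is needed. -/

/-! ### Mean excess of Gaussian variables over a level. -/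

theorem gaussianPDFReal_zero_one (x : ℝ) :
    gaussianPDFReal 0 1 x = (√(2 * Real.pi))⁻¹ * Real.exp (-(1 / 2) * x ^ 2) := by
  rw [gaussianPDFReal_def]
  simp
  left
  ring

theorem integrable_mul_gaussianPDFReal : Integrable (fun x => x * gaussianPDFReal 0 1 x) := by
  have h := (integrable_mul_exp_neg_mul_sq (b := 1 / 2) (by norm_num)).const_mul
    (√(2 * Real.pi))⁻¹
  refine h.congr (.of_forall fun x => ?_)
  simp only [gaussianPDFReal_zero_one]
  ring

theorem setIntegral_Ioi_mul_gaussianPDFReal :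
    ∫ x in Set.Ioi 0, x * gaussianPDFReal 0 1 x = (√(2 * Real.pi))⁻¹ := by
  have h := integral_rpow_mul_exp_neg_mul_rpow (p := 2) (q := 1) (b := 1 / 2)
    (by norm_num) (by norm_num) (by norm_num)
  norm_num at h
  simp_rw [gaussianPDFReal_zero_one]
  have : ∀ x : ℝ, x * ((√(2 * Real.pi))⁻¹ * Real.exp (-(1 / 2) * x ^ 2))
      = (√(2 * Real.pi))⁻¹ * (x * Real.exp (-((1 / 2) * x ^ 2))) := fun x => by ring_nf
  simp_rw [this]
  rw [integral_const_mul, h, mul_one]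

theorem setIntegral_Ioi_gaussianPDFReal :
    ∫ x in Set.Ioi 0, gaussianPDFReal 0 1 x = 1 / 2 := by
  simp_rw [gaussianPDFReal_zero_one]
  rw [integral_const_mul, integral_gaussian_Ioi]
  rw [show Real.pi / (1 / 2) = 2 * Real.pi by ring]
  have : √(2 * Real.pi) ≠ 0 := by positivity
  field_simp

theorem inv_sqrt_two_pi_le_half : (√(2 * Real.pi))⁻¹ ≤ 1 / 2 := by
  rw [inv_le_comm₀ (by positivity) (by norm_num)]
  apply Real.le_sqrt_of_sq_le
  nlinarith [Real.pi_gt_three]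

theorem integrable_gaussian_of_abs_le {μ : ℝ} {v : NNReal} {f : ℝ → ℝ} (hf : Measurable f)
    {C D : ℝ} (h : ∀ x, |f x| ≤ C + D * |x|) : Integrable f (gaussianReal μ v) := by
  have h1 : Integrable (fun x : ℝ => x) (gaussianReal μ v) := by
    have := memLp_id_gaussianReal (μ := μ) (v := v) 1
    exact memLp_one_iff_integrable.1 (show MemLp id 1 _ by simpa using this)
  refine Integrable.mono' ((integrable_const C).add (h1.abs.const_mul D))
    hf.aestronglyMeasurable (.of_forall fun x => ?_)
  simpa using h x

theorem integrable_gaussian_posPart_sub (μ : ℝ) (v : NNReal) (c : ℝ) :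
    Integrable (fun x => max (x - c) 0) (gaussianReal μ v) := by
  refine integrable_gaussian_of_abs_le (C := |c|) (D := 1) (by fun_prop) fun x => ?_
  rw [abs_of_nonneg (le_max_right _ _)]
  refine max_le ?_ (by positivity)
  linarith [neg_abs_le c, le_abs_self x]

theorem integral_gaussian_posPart :
    ∫ x, max x 0 ∂(gaussianReal 0 1) = (√(2 * Real.pi))⁻¹ := by
  rw [integral_gaussianReal_eq_integral_smul one_ne_zero,
    ← setIntegral_Ioi_mul_gaussianPDFReal, ← integral_indicator measurableSet_Ioi]
  congr 1
  ext x
  by_cases hx : 0 < x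
  · simp [Set.indicator, hx, hx.le, mul_comm]
  · simp [Set.indicator, hx, not_lt.1 hx]

theorem gaussianReal_real_Ici (b : ℝ) :
    (gaussianReal 0 1).real (Set.Ici b) = ∫ x in Set.Ioi b, gaussianPDFReal 0 1 x := by
  rw [measureReal_def, gaussianReal_apply_eq_integral _ one_ne_zero, integral_Ici_eq_integral_Ioi,
    ENNReal.toReal_ofReal]
  exact integral_nonneg fun x => gaussianPDFReal_nonneg _ _ _

theorem integral_gaussian_posPart_sub (b : ℝ) :
    ∫ x, max (x - b) 0 ∂(gaussianReal 0 1) =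
      ∫ x in Set.Ioi b, (x - b) * gaussianPDFReal 0 1 x := by
  rw [integral_gaussianReal_eq_integral_smul one_ne_zero, ← integral_indicator measurableSet_Ioi]
  congr 1
  ext x
  by_cases hx : b < x
  · simp [Set.indicator, hx, hx.le, mul_comm]
  · simp [Set.indicator, hx, not_lt.1 hx]

/-- Shifting the density multiplies it by `exp (-b * y - b ^ 2 / 2)`. This factor decreases in `y`
while `y - 1` changes sign from negative to positive at `1`, so freezing the factor at `y = 1` can
only increase the product. -/
theorem gaussianPDFReal_shift_weight_le {b : ℝ} (hb : 0 ≤ b) (y : ℝ) :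
    (y - 1) * gaussianPDFReal 0 1 (y + b) ≤
      Real.exp (-b - b ^ 2 / 2) * ((y - 1) * gaussianPDFReal 0 1 y) := by
  have h1 : gaussianPDFReal 0 1 (y + b)
      = gaussianPDFReal 0 1 y * (Real.exp (-b * y) * Real.exp (-b ^ 2 / 2)) := by
    simp only [gaussianPDFReal_zero_one, mul_assoc, ← Real.exp_add]
    ring_nf
  have h2 : Real.exp (-b - b ^ 2 / 2) = Real.exp (-b) * Real.exp (-b ^ 2 / 2) := by
    rw [← Real.exp_add]; ring_nf
  have h3 : (y - 1) * Real.exp (-b * y) ≤ (y - 1) * Real.exp (-b) := by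
    rcases le_total 1 y with h | h
    · exact mul_le_mul_of_nonneg_left (Real.exp_le_exp.2 (by nlinarith)) (by linarith)
    · exact mul_le_mul_of_nonpos_left (Real.exp_le_exp.2 (by nlinarith)) (by linarith)
  have h4 : 0 ≤ gaussianPDFReal 0 1 y * Real.exp (-b ^ 2 / 2) :=
    mul_nonneg (gaussianPDFReal_nonneg _ _ _) (Real.exp_nonneg _)
  rw [h1, h2]
  nlinarith [mul_le_mul_of_nonneg_right h3 h4]

/-- The claim is that `x - b - 1` has nonpositive integral over `x > b`. The shift inequality
reduces it to `b = 0`, where it says `1 / √(2π) ≤ 1 / 2`. -/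
theorem integral_gaussian_posPart_sub_le_of_nonneg {b : ℝ} (hb : 0 ≤ b) :
    ∫ x, max (x - b) 0 ∂(gaussianReal 0 1) ≤ (gaussianReal 0 1).real (Set.Ici b) := by
  have hi0 := integrable_gaussianPDFReal 0 1
  have hi1 := integrable_mul_gaussianPDFReal
  have hw : Integrable (fun y => (y - 1) * gaussianPDFReal 0 1 y) := by
    refine (hi1.sub hi0).congr (.of_forall fun y => ?_)
    simp only [Pi.sub_apply]; ring
  have hwb : Integrable (fun x => (x - b - 1) * gaussianPDFReal 0 1 x) := by
    refine (hi1.sub (hi0.const_mul (b + 1))).congr (.of_forall fun y => ?_)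
    simp only [Pi.sub_apply]; ring
  have key : ∫ x in Set.Ioi b, (x - b - 1) * gaussianPDFReal 0 1 x ≤ 0 := by
    calc ∫ x in Set.Ioi b, (x - b - 1) * gaussianPDFReal 0 1 x
        ≤ ∫ x in Set.Ioi b, Real.exp (-b - b ^ 2 / 2) *
            ((x - b - 1) * gaussianPDFReal 0 1 (x - b)) := by
          refine integral_mono hwb.integrableOn
            (((hw.comp_sub_right b).const_mul _).integrableOn) fun x => ?_
          have := gaussianPDFReal_shift_weight_le hb (x - b)
          simpa using this
      _ = Real.exp (-b - b ^ 2 / 2) *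
            ∫ x in Set.Ioi b, (x - b - 1) * gaussianPDFReal 0 1 (x - b) := by
          rw [integral_const_mul]
      _ = Real.exp (-b - b ^ 2 / 2) *
            ∫ x in Set.Ioi 0, (x - 1) * gaussianPDFReal 0 1 x := by
          congr 1
          rw [← integral_indicator measurableSet_Ioi, ← integral_indicator measurableSet_Ioi,
            ← integral_sub_right_eq_self
              ((Set.Ioi 0).indicator fun x => (x - 1) * gaussianPDFReal 0 1 x) b]
          congr 1
          ext x
          simp [Set.indicator]
      _ ≤ 0 := by
          refine mul_nonpos_of_nonneg_of_nonpos (Real.exp_nonneg _) ?_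
          simp_rw [sub_mul, one_mul]
          rw [integral_sub hi1.integrableOn hi0.integrableOn,
            setIntegral_Ioi_mul_gaussianPDFReal, setIntegral_Ioi_gaussianPDFReal]
          linarith [inv_sqrt_two_pi_le_half]
  rw [integral_gaussian_posPart_sub, gaussianReal_real_Ici]
  have : ∀ x, (x - b) * gaussianPDFReal 0 1 x =
    (x - b - 1) * gaussianPDFReal 0 1 x + gaussianPDFReal 0 1 x := fun x => by ring
  simp_rw [this]
  rw [integral_add hwb.integrableOn hi0.integrableOn]
  linarith

/-- The mean excess of a standard normal variable over a level `b`. -/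
theorem integral_gaussian_posPart_sub_le (b : ℝ) :
    ∫ x, max (x - b) 0 ∂(gaussianReal 0 1) ≤
      (1 + max (-b) 0) * (gaussianReal 0 1).real (Set.Ici b) := by
  rcases le_total 0 b with hb | hb
  · rw [max_eq_right (by linarith), add_zero, one_mul]
    exact integral_gaussian_posPart_sub_le_of_nonneg hb
  · rw [max_eq_left (by linarith)]
    have h0 := integral_gaussian_posPart_sub_le_of_nonneg le_rfl
    have hm : (gaussianReal 0 1).real (Set.Ici 0) ≤ (gaussianReal 0 1).real (Set.Ici b) :=
      measureReal_mono (Set.Ici_subset_Ici.2 hb)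
    -- For `b ≤ 0`, the excess over `b` is at most the excess over `0` plus `-b` on the event `x ≥
    -- b`.
    calc ∫ x, max (x - b) 0 ∂(gaussianReal 0 1)
        ≤ ∫ x, (max (x - 0) 0 + (Set.Ici b).indicator (fun _ => -b) x) ∂(gaussianReal 0 1) := by
          refine integral_mono (integrable_gaussian_posPart_sub _ _ _)
            ((integrable_gaussian_posPart_sub _ _ _).add
              ((integrable_const _).indicator measurableSet_Ici)) fun x => ?_
          by_cases hx : b ≤ x
          · simp only [Set.indicator, Set.mem_Ici, hx, if_true, sub_zero]
            refine max_le ?_ (by linarith [le_max_right x 0])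
            linarith [le_max_left x 0]
          · simp only [Set.indicator, Set.mem_Ici, hx, if_false, sub_zero, add_zero]
            refine max_le ?_ (le_max_right _ _)
            linarith [le_max_right x 0]
      _ = ∫ x, max (x - 0) 0 ∂(gaussianReal 0 1)
            + (gaussianReal 0 1).real (Set.Ici b) * -b := by
          rw [integral_add (integrable_gaussian_posPart_sub _ _ _)
              ((integrable_const _).indicator measurableSet_Ici),
            integral_indicator_const _ measurableSet_Ici, smul_eq_mul]
      _ ≤ _ := by nlinarith

theorem gaussianReal_eq_map (m : ℝ) (v : NNReal) :
    gaussianReal m v = (gaussianReal 0 1).map (fun z => m + √v * z) := by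
  have h1 : (fun z : ℝ => m + √v * z) = (fun z => m + z) ∘ (fun z => √v * z) := rfl
  rw [h1, ← Measure.map_map (by fun_prop) (by fun_prop), gaussianReal_map_const_mul,
    gaussianReal_map_const_add]
  congr 1
  · simp
  · ext; simp

/-- The mean excess of a normal variable with mean `s` and variance at most one over a positive
level. -/
theorem integral_gaussian_excess_le {s c : ℝ} (hs : 0 ≤ s) (hc : 0 < c) {v : NNReal}
    (hv0 : 0 < v) (hv : v ≤ 1) :
    ∫ x, max (x - c) 0 ∂(gaussianReal s v) ≤ (s + 1) * (gaussianReal s v).real (Set.Ici c) := by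
  have hσ : 0 < √(v : ℝ) := Real.sqrt_pos.2 (by exact_mod_cast hv0)
  have hσ1 : √(v : ℝ) ≤ 1 := Real.sqrt_le_one.2 (by exact_mod_cast hv)
  set σ := √(v : ℝ) with hσdef
  rw [gaussianReal_eq_map, integral_map (by fun_prop) (by fun_prop),
    map_measureReal_apply (by fun_prop) measurableSet_Ici, ← hσdef]
  set b := (c - s) / σ
  have hb : σ * b = c - s := by simp only [b]; field_simp
  have hpre : (fun z => s + σ * z) ⁻¹' Set.Ici c = Set.Ici b := by
    ext z
    simp only [Set.mem_preimage, Set.mem_Ici]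
    rw [div_le_iff₀ hσ]
    constructor <;> intro h <;> linarith
  have hint : ∀ z, max (s + σ * z - c) 0 = σ * max (z - b) 0 := fun z => by
    rw [mul_max_of_nonneg _ _ hσ.le, mul_sub, hb, mul_zero]
    congr 1; ring
  simp_rw [hint]
  rw [hpre, integral_const_mul]
  have := integral_gaussian_posPart_sub_le b
  -- Here `σ * max (-b) 0` is the positive part of `s - c`, at most `s` because the level `c` is
  -- positive; the other term is `σ ≤ 1`.
  have hco : σ * (1 + max (-b) 0) ≤ s + 1 := by
    rw [mul_add, mul_max_of_nonneg _ _ hσ.le, mul_neg, hb, mul_zero]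
    have : max (-(c - s)) 0 ≤ s := max_le (by linarith) hs
    linarith
  calc _ ≤ σ * ((1 + max (-b) 0) * (gaussianReal 0 1).real (Set.Ici b)) :=
        mul_le_mul_of_nonneg_left this hσ.le
    _ = (σ * (1 + max (-b) 0)) * (gaussianReal 0 1).real (Set.Ici b) := by ring
    _ ≤ _ := mul_le_mul_of_nonneg_right hco measureReal_nonneg

theorem integral_gaussian_centered_posPart (v : NNReal) :
    ∫ x, max x 0 ∂(gaussianReal 0 v) = √v / √(2 * Real.pi) := by
  rw [gaussianReal_eq_map, integral_map (by fun_prop) (by fun_prop)]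
  have hint : ∀ z : ℝ, max (0 + √(v : ℝ) * z) 0 = √v * max z 0 := fun z => by
    rw [mul_max_of_nonneg _ _ (Real.sqrt_nonneg _), zero_add, mul_zero]
  simp_rw [hint]
  rw [integral_const_mul, integral_gaussian_posPart]
  rfl

/-! ### Pathwise inequalities around a crossing. -/

section CrossingCombinatorics

variable {Ω : Type*} {a : ℕ → Ω → ℝ} {l : ℝ}

/-- The event that the partial sums of `a` stay below `l` up to time `t`. -/
def staysBelow (a : ℕ → Ω → ℝ) (l : ℝ) (t : ℕ) : Set Ω :=
  {ω | ∀ i ≤ t, ∑ j ∈ Finset.range i, a j ω < l}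

theorem staysBelow_antitone : Antitone (staysBelow a l) :=
  fun _ _ hst _ hω i hi => hω i (hi.trans hst)

theorem mem_staysBelow_succ {t : ℕ} {ω : Ω} :
    ω ∈ staysBelow a l (t + 1) ↔
      ω ∈ staysBelow a l t ∧ ∑ j ∈ Finset.range (t + 1), a j ω < l := by
  constructor
  · intro h
    exact ⟨staysBelow_antitone t.le_succ h, h _ le_rfl⟩
  · rintro ⟨h1, h2⟩ i hi
    rcases Nat.le_succ_iff.1 hi with h | rfl
    · exact h1 i h
    · exact h2

theorem mem_staysBelow_zero (hl : 0 < l) (ω : Ω) : ω ∈ staysBelow a l 0 := by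
  intro i hi
  obtain rfl := Nat.le_zero.1 hi
  simpa using hl

theorem sum_indicator_of_mem {K : ℕ → Set Ω} (hK : Antitone K) {n : ℕ} {ω : Ω} (h : ω ∈ K n) :
    ∑ i ∈ Finset.range n, (K i).indicator (a i) ω = ∑ i ∈ Finset.range n, a i ω :=
  Finset.sum_congr rfl fun _ hi =>
    Set.indicator_of_mem (hK (Finset.mem_range.1 hi).le h) _

theorem sum_indicator_succ_of_mem {K : ℕ → Set Ω} (hK : Antitone K) {n : ℕ} {ω : Ω}
    (h : ω ∈ K n) :
    ∑ i ∈ Finset.range (n + 1), (K i).indicator (a i) ω =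
      ∑ i ∈ Finset.range (n + 1), a i ω := by
  rw [Finset.sum_range_succ, Finset.sum_range_succ, sum_indicator_of_mem hK h,
    Set.indicator_of_mem h]

/-- The set `staysBelow a l i` depends on sums up to time `i`, so the step that crosses is still
counted and the sum then freezes at a value at least `l`. -/
theorem le_stopped_sum (hl : 0 < l) {n : ℕ} {ω : Ω} (h : ω ∉ staysBelow a l n) :
    l ≤ ∑ i ∈ Finset.range n, (staysBelow a l i).indicator (a i) ω := by
  induction n with
  | zero => exact absurd (mem_staysBelow_zero hl ω) h
  | succ n ih =>
    by_cases hn : ω ∈ staysBelow a l n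
    · rw [sum_indicator_succ_of_mem staysBelow_antitone hn]
      by_contra! hlt
      exact h (mem_staysBelow_succ.2 ⟨hn, hlt⟩)
    · rw [Finset.sum_range_succ, Set.indicator_of_notMem hn, add_zero]
      exact ih hn

/-- Increments collected between a time `R` with `{R > t} = K t` and the crossing time of `l`. -/
theorem sum_indicator_compl_inter_staysBelow_le {K : ℕ → Set Ω} (hK : Antitone K) (n : ℕ) (ω : Ω) :
    ∑ t ∈ Finset.range n, ((K t)ᶜ ∩ staysBelow a l t).indicator
        (fun ω => a t ω - max (∑ j ∈ Finset.range (t + 1), a j ω - l) 0) ω ≤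
      (K n)ᶜ.indicator
        (fun ω => max (l - ∑ i ∈ Finset.range n, (K i).indicator (a i) ω) 0) ω := by
  set S : ℕ → ℝ := fun n => ∑ i ∈ Finset.range n, (K i).indicator (a i) ω with hS
  set A : ℕ → ℝ := fun n => ∑ i ∈ Finset.range n, a i ω with hA
  set L : ℕ → ℝ := fun n => ∑ t ∈ Finset.range n, ((K t)ᶜ ∩ staysBelow a l t).indicator
        (fun ω => a t ω - max (∑ j ∈ Finset.range (t + 1), a j ω - l) 0) ω with hL
  have hAs : ∀ n, A (n + 1) = A n + a n ω := fun n => Finset.sum_range_succ _ _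
  -- Invariant in three phases: before `R` nothing is collected; between `R` and the crossing, `L`
  -- is the displacement since `R`; at the crossing step the overshoot is subtracted, which leaves
  -- exactly `l - S`. If the crossing precedes `R`, then `L` stays `0`, whence the maximum with `0`.
  have main : ∀ n, (ω ∈ K n → L n = 0) ∧
      (ω ∉ K n → ω ∈ staysBelow a l n → L n = A n - S n) ∧
      (ω ∉ K n → ω ∉ staysBelow a l n → L n ≤ max (l - S n) 0) := by
    intro n
    induction n with
    | zero => simp [hL, hA, hS]
    | succ n ih =>
      obtain ⟨h1, h2, h3⟩ := ih
      by_cases hKn : ω ∈ K n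
      · have hLs : L (n + 1) = 0 := by
          rw [hL]; simp only
          rw [Finset.sum_range_succ, Set.indicator_of_notMem (fun h => h.1 hKn), add_zero]
          exact h1 hKn
        have hSs : S (n + 1) = A (n + 1) := sum_indicator_succ_of_mem hK hKn
        refine ⟨fun _ => hLs, fun _ _ => ?_, fun _ _ => ?_⟩
        · rw [hLs, hSs, sub_self]
        · rw [hLs]; exact le_max_right _ _
      · have hKs : ω ∉ K (n + 1) := fun h => hKn (hK n.le_succ h)
        have hSs : S (n + 1) = S n := by
          rw [hS]; simp only
          rw [Finset.sum_range_succ, Set.indicator_of_notMem hKn, add_zero]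
        refine ⟨fun h => absurd h hKs, fun _ hG => ?_, fun _ hG => ?_⟩
        · obtain ⟨hGn, hlt⟩ := mem_staysBelow_succ.1 hG
          have : L (n + 1) = L n + (a n ω - max (A (n + 1) - l) 0) := by
            rw [hL]; simp only
            rw [Finset.sum_range_succ, Set.indicator_of_mem (Set.mem_inter hKn hGn)]
          rw [this, h2 hKn hGn, hSs, hAs,
            max_eq_right (by rw [← hAs]; exact (sub_neg.2 hlt).le)]
          ring
        · by_cases hGn : ω ∈ staysBelow a l n
          · have hle : l ≤ A (n + 1) := by
              by_contra! hlt
              exact hG (mem_staysBelow_succ.2 ⟨hGn, hlt⟩)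
            have : L (n + 1) = L n + (a n ω - max (A (n + 1) - l) 0) := by
              rw [hL]; simp only
              rw [Finset.sum_range_succ, Set.indicator_of_mem (Set.mem_inter hKn hGn)]
            rw [this, h2 hKn hGn, hSs, max_eq_left (by linarith), hAs]
            refine le_trans (le_of_eq ?_) (le_max_left _ _)
            ring
          · have : L (n + 1) = L n := by
              rw [hL]; simp only
              rw [Finset.sum_range_succ, Set.indicator_of_notMem (fun h => hGn h.2), add_zero]
            rw [this, hSs]
            exact h3 hKn hGn
  obtain ⟨h1, h2, h3⟩ := main n
  by_cases hKn : ω ∈ K n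
  · rw [Set.indicator_of_notMem (Set.notMem_compl_iff.2 hKn)]
    exact (h1 hKn).le
  · rw [Set.indicator_of_mem hKn]
    by_cases hG : ω ∈ staysBelow a l n
    · have hlt : A n < l := hG n le_rfl
      refine le_trans (h2 hKn hG).le (le_trans ?_ (le_max_left _ _))
      exact sub_le_sub_right hlt.le _
    · exact h3 hKn hG

/-- Increments collected between the crossing time of `l` and time `n`. -/
theorem sum_indicator_compl_staysBelow_le (hl : 0 < l) (n : ℕ) (ω : Ω) :
    ∑ t ∈ Finset.range n, (staysBelow a l t)ᶜ.indicator (a t) ω ≤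
      max (∑ j ∈ Finset.range n, a j ω - l) 0 := by
  have main : (ω ∈ staysBelow a l n →
        ∑ t ∈ Finset.range n, (staysBelow a l t)ᶜ.indicator (a t) ω = 0) ∧
      (ω ∉ staysBelow a l n → ∑ t ∈ Finset.range n, (staysBelow a l t)ᶜ.indicator (a t) ω ≤
        ∑ j ∈ Finset.range n, a j ω - l) := by
    induction n with
    | zero => exact ⟨fun _ => by simp, fun h => absurd (mem_staysBelow_zero hl ω) h⟩
    | succ n ih =>
      obtain ⟨h1, h2⟩ := ih
      by_cases hn : ω ∈ staysBelow a l n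
      · rw [Finset.sum_range_succ, h1 hn, Set.indicator_of_notMem (Set.notMem_compl_iff.2 hn), add_zero]
        refine ⟨fun _ => rfl, fun h => ?_⟩
        by_contra! hlt
        exact h (mem_staysBelow_succ.2 ⟨hn, by linarith⟩)
      · refine ⟨fun h => absurd (staysBelow_antitone n.le_succ h) hn, fun _ => ?_⟩
        rw [Finset.sum_range_succ, Set.indicator_of_mem hn, Finset.sum_range_succ]
        linarith [h2 hn]
  by_cases hn : ω ∈ staysBelow a l n
  · rw [main.1 hn]; exact le_max_right _ _
  · exact (main.2 hn).trans (le_max_left _ _)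

end CrossingCombinatorics

/-! ### Gaussian increments adapted to a filtration, and their martingale transforms. -/

section Innovations

variable {Ω : Type*} {mΩ : MeasurableSpace Ω}

/-- The sequence `a` consists of normal variables with mean `μ` and variance `v`, where `a i` is
known at time `i + 1` and is independent of the past up to time `i`. -/
structure IsGaussianInnovation (P : Measure Ω) (F : Filtration ℕ mΩ) (a : ℕ → Ω → ℝ) (μ : ℝ)
    (v : NNReal) : Prop where
  measurable_succ (i : ℕ) : Measurable[F (i + 1)] (a i)
  indep (i : ℕ) : Indep (F i) (MeasurableSpace.comap (a i) inferInstance) P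
  law (i : ℕ) : HasLaw (a i) (gaussianReal μ v) P

variable {P : Measure Ω} {F : Filtration ℕ mΩ} {a : ℕ → Ω → ℝ} {μ : ℝ} {v : NNReal}

namespace IsGaussianInnovation

theorem measurable (h : IsGaussianInnovation P F a μ v) (i : ℕ) : Measurable (a i) :=
  (h.measurable_succ i).mono (F.le _) le_rfl

theorem measurable_sum (h : IsGaussianInnovation P F a μ v) (t : ℕ) :
    Measurable[F t] fun ω => ∑ i ∈ Finset.range t, a i ω := by
  refine Finset.measurable_fun_sum _ fun i hi => ?_
  exact (h.measurable_succ i).mono (F.mono (Finset.mem_range.1 hi)) le_rfl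

theorem measurableSet_staysBelow (h : IsGaussianInnovation P F a μ v) (l : ℝ) (t : ℕ) :
    MeasurableSet[F t] (staysBelow a l t) := by
  have : staysBelow a l t = ⋂ i ∈ Set.Iic t, {ω | ∑ j ∈ Finset.range i, a j ω < l} := by
    ext ω; simp [staysBelow]
  rw [this]
  refine MeasurableSet.biInter (Set.to_countable _) fun i hi => ?_
  exact F.mono hi _ (measurableSet_lt (h.measurable_sum i) measurable_const)

theorem memLp (h : IsGaussianInnovation P F a μ v) (i : ℕ) : MemLp (a i) 2 P := by
  have h1 := memLp_id_gaussianReal (μ := μ) (v := v) 2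
  rw [← (h.law i).map_eq, memLp_map_measure_iff (by fun_prop) (h.law i).aemeasurable] at h1
  exact h1

theorem integral_eq (h : IsGaussianInnovation P F a μ v) (i : ℕ) : ∫ ω, a i ω ∂P = μ := by
  rw [(h.law i).integral_eq, integral_id_gaussianReal]

theorem integral_sq (h : IsGaussianInnovation P F a 0 v) [IsProbabilityMeasure P] (i : ℕ) :
    ∫ ω, a i ω ^ 2 ∂P = v := by
  have h1 := (h.law i).variance_eq
  rw [variance_id_gaussianReal, variance_eq_sub (h.memLp i)] at h1
  simpa [h.integral_eq i] using h1

theorem indepFun (h : IsGaussianInnovation P F a μ v) {i : ℕ} {g : Ω → ℝ}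
    (hg : Measurable[F i] g) : IndepFun g (a i) P :=
  indep_of_indep_of_le_left (h.indep i) hg.comap_le

theorem integrable [IsFiniteMeasure P] (h : IsGaussianInnovation P F a μ v) (i : ℕ) :
    Integrable (a i) P :=
  (h.memLp i).integrable one_le_two

theorem integral_indicator [IsProbabilityMeasure P] (h : IsGaussianInnovation P F a μ v) {i : ℕ}
    {H : Set Ω} (hH : MeasurableSet[F i] H) :
    ∫ ω, H.indicator (a i) ω ∂P = μ * P.real H := by
  have hg : Measurable[F i] (H.indicator fun _ => (1 : ℝ)) :=
    (@measurable_const _ _ _ (F i) 1).indicator hH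
  have h1 := (h.indepFun hg).integral_fun_mul_eq_mul_integral
    (hg.mono (F.le _) le_rfl).aestronglyMeasurable (h.measurable i).aestronglyMeasurable
  have h2 : ∀ ω, H.indicator (a i) ω = H.indicator (fun _ => (1 : ℝ)) ω * a i ω := fun ω => by
    by_cases hω : ω ∈ H <;> simp [hω]
  simp_rw [h2]
  rw [h1, h.integral_eq, integral_indicator_const _ (F.le _ _ hH)]
  simp [mul_comm]

/-- The expected excess of `a i` over a level known at time `i`. -/
theorem integral_indicator_excess_le [IsProbabilityMeasure P] {s : ℝ} (hs : 0 ≤ s)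
    (h : IsGaussianInnovation P F a s v) (hv0 : 0 < v) (hv : v ≤ 1) {i : ℕ} {H : Set Ω}
    (hH : MeasurableSet[F i] H) {c : Ω → ℝ} (hc : Measurable[F i] c) (hpos : ∀ ω ∈ H, 0 < c ω) :
    ∫ ω, H.indicator (fun ω => max (a i ω - c ω) 0) ω ∂P ≤
      (s + 1) * P.real (H ∩ {ω | c ω ≤ a i ω}) := by
  have hYF : Measurable[F i] (H.indicator c) := hc.indicator hH
  have hY : Measurable (H.indicator c) := hYF.mono (F.le _) le_rfl
  have ha := h.measurable i
  -- The pair `(H.indicator c, a i)` has a product law, so Fubini applies with the level fixed. Off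
  -- `H` the first coordinate is `0`, so restricting `f` and `g` to a positive first coordinate
  -- encodes the event `H`.
  set f : ℝ × ℝ → ℝ := {p | 0 < p.1}.indicator (fun p => max (p.2 - p.1) 0) with hf
  set g : ℝ × ℝ → ℝ := {p | 0 < p.1 ∧ p.1 ≤ p.2}.indicator (fun _ => 1) with hg
  have hpm : MeasurableSet {p : ℝ × ℝ | 0 < p.1} := measurableSet_lt measurable_const measurable_fst
  have hqm : MeasurableSet {p : ℝ × ℝ | 0 < p.1 ∧ p.1 ≤ p.2} :=
    hpm.inter (measurableSet_le measurable_fst measurable_snd)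
  have hfm : Measurable f := Measurable.indicator (by fun_prop) hpm
  have hgm : Measurable g := Measurable.indicator measurable_const hqm
  have hmap : P.map (fun ω => (H.indicator c ω, a i ω)) =
      (P.map (H.indicator c)).prod (gaussianReal s v) := by
    rw [(indepFun_iff_map_prod_eq_prod_map_map hY.aemeasurable ha.aemeasurable).1
      (h.indepFun hYF), (h.law i).map_eq]
  have : IsProbabilityMeasure (P.map (H.indicator c)) := Measure.isProbabilityMeasure_map hY.aemeasurable
  have hfi : Integrable f ((P.map (H.indicator c)).prod (gaussianReal s v)) := by
    rw [← hmap, integrable_map_measure hfm.aestronglyMeasurable (by fun_prop)]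
    refine Integrable.mono' (h.integrable i).abs
      (hfm.comp (hY.prodMk ha)).aestronglyMeasurable (.of_forall fun ω => ?_)
    by_cases h1 : 0 < H.indicator c ω
    · have h2 : f (H.indicator c ω, a i ω) = max (a i ω - H.indicator c ω) 0 :=
        Set.indicator_of_mem (s := {p : ℝ × ℝ | 0 < p.1}) h1 _
      rw [Function.comp, h2, Real.norm_eq_abs, abs_of_nonneg (le_max_right _ _)]
      exact max_le (by linarith [le_abs_self (a i ω)]) (abs_nonneg _)
    · have h2 : f (H.indicator c ω, a i ω) = 0 :=
        Set.indicator_of_notMem (s := {p : ℝ × ℝ | 0 < p.1}) h1 _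
      rw [Function.comp, h2, norm_zero]
      exact abs_nonneg _
  have hgi : Integrable g ((P.map (H.indicator c)).prod (gaussianReal s v)) :=
    (integrable_const _).indicator hqm
  have e1 : ∫ ω, H.indicator (fun ω => max (a i ω - c ω) 0) ω ∂P =
      ∫ y, ∫ x, f (y, x) ∂(gaussianReal s v) ∂(P.map (H.indicator c)) := by
    rw [← integral_prod _ hfi, ← hmap, integral_map (by fun_prop) hfm.aestronglyMeasurable]
    congr 1; ext ω
    by_cases hω : ω ∈ H
    · simp [hf, hω, hpos ω hω]
    · simp [hf, hω]
  have e2 : P.real (H ∩ {ω | c ω ≤ a i ω}) =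
      ∫ y, ∫ x, g (y, x) ∂(gaussianReal s v) ∂(P.map (H.indicator c)) := by
    have hm : MeasurableSet (H ∩ {ω | c ω ≤ a i ω}) :=
      (F.le _ _ hH).inter (measurableSet_le (hc.mono (F.le _) le_rfl) ha)
    rw [← integral_prod _ hgi, ← hmap, integral_map (by fun_prop) hgm.aestronglyMeasurable,
      ← integral_indicator_one hm]
    congr 1; ext ω
    by_cases hω : ω ∈ H
    · by_cases hca : c ω ≤ a i ω <;> simp [hg, hω, hpos ω hω, hca]
    · simp [hg, hω]
  rw [e1, e2, ← integral_const_mul]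
  refine integral_mono hfi.integral_prod_left (hgi.integral_prod_left.const_mul _) fun y => ?_
  by_cases hy : 0 < y
  · have := integral_gaussian_excess_le hs hy hv0 hv
    have e3 : ∀ x, g (y, x) = (Set.Ici y).indicator 1 x := fun x => by
      by_cases hx : y ≤ x <;> simp [hg, hy, hx]
    have e4 : ∀ x, f (y, x) = max (x - y) 0 := fun x => by simp [hf, hy]
    simp only [e3, e4]
    rwa [integral_indicator_one measurableSet_Ici]
  · simp [hf, hg, hy]

theorem integral_posPart_sum [IsProbabilityMeasure P] (h : IsGaussianInnovation P F a 0 v)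
    (N : ℕ) :
    ∫ ω, max (∑ i ∈ Finset.range N, a i ω) 0 ∂P = √(N * v) / √(2 * Real.pi) := by
  have hlaw : ∀ N : ℕ, HasLaw (fun ω => ∑ i ∈ Finset.range N, a i ω)
      (gaussianReal 0 (N * v)) P := by
    intro N
    induction N with
    | zero =>
      simp only [Finset.range_zero, Finset.sum_empty, Nat.cast_zero, zero_mul,
        gaussianReal_zero_var]
      exact ⟨aemeasurable_const, by simp⟩
    | succ N ih =>
      have hind : IndepFun (fun ω => ∑ i ∈ Finset.range N, a i ω) (a N) P :=
        h.indepFun (h.measurable_sum N)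
      have := hind.hasLaw_fun_add ih (h.law N)
      rw [gaussianReal_conv_gaussianReal] at this
      simp_rw [Finset.sum_range_succ]
      convert this using 2
      · simp
      · push_cast; ring
  have h1 := (hlaw N).integral_comp (f := fun x => max x 0) (by fun_prop)
  rw [integral_gaussian_centered_posPart] at h1
  simpa [Function.comp_def] using h1

theorem sub_const [IsProbabilityMeasure P] (h : IsGaussianInnovation P F a μ v) :
    IsGaussianInnovation P F (fun i ω => a i ω - μ) 0 v where
  measurable_succ i := (h.measurable_succ i).sub_const μ
  indep i := by
    refine indep_of_indep_of_le_right (h.indep i) ?_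
    have : Measurable[MeasurableSpace.comap (a i) inferInstance] (fun ω => a i ω - μ) :=
      (comap_measurable (a i)).sub_const μ
    exact this.comap_le
  law i := by simpa using gaussianReal_sub_const (h.law i) μ

/-- First and second moments of a martingale transform. -/
theorem moments_transform [IsProbabilityMeasure P] (h : IsGaussianInnovation P F a 0 v)
    {θ : ℕ → Ω → ℝ} (hθ : ∀ i, Measurable[F i] (θ i)) (hb : ∀ i ω, |θ i ω| ≤ 1) (n : ℕ) :
    MemLp (fun ω => ∑ i ∈ Finset.range n, θ i ω * a i ω) 2 P ∧
    ∫ ω, ∑ i ∈ Finset.range n, θ i ω * a i ω ∂P = 0 ∧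
    ∫ ω, (∑ i ∈ Finset.range n, θ i ω * a i ω) ^ 2 ∂P =
      v * ∑ i ∈ Finset.range n, ∫ ω, θ i ω ^ 2 ∂P := by
  have hθ' : ∀ i, Measurable (θ i) := fun i => (hθ i).mono (F.le _) le_rfl
  have hL : ∀ i, MemLp (fun ω => θ i ω * a i ω) 2 P := fun i => by
    refine (h.memLp i).mono ((hθ' i).mul (h.measurable i)).aestronglyMeasurable
      (.of_forall fun ω => ?_)
    rw [norm_mul]
    exact mul_le_of_le_one_left (norm_nonneg _) (hb i ω)
  induction n with
  | zero => simp
  | succ n ih =>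
    obtain ⟨ih0, ih1, ih2⟩ := ih
    have hMF : Measurable[F n] fun ω => ∑ i ∈ Finset.range n, θ i ω * a i ω := by
      refine Finset.measurable_fun_sum _ fun i hi => ?_
      have hi := Finset.mem_range.1 hi
      exact ((hθ i).mono (F.mono hi.le) le_rfl).mul
        ((h.measurable_succ i).mono (F.mono hi) le_rfl)
    set M : Ω → ℝ := fun ω => ∑ i ∈ Finset.range n, θ i ω * a i ω with hM
    have hMm : Measurable M := hMF.mono (F.le _) le_rfl
    have ham := h.measurable n
    have i1 : ∫ ω, θ n ω * a n ω ∂P = 0 := by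
      rw [(h.indepFun (hθ n)).integral_fun_mul_eq_mul_integral (hθ' n).aestronglyMeasurable
        ham.aestronglyMeasurable, h.integral_eq, mul_zero]
    -- Orthogonality of martingale increments: `M * θ n` is known at time `n` and `a n` is centred
    -- and independent of it.
    have i2 : ∫ ω, M ω * (θ n ω * a n ω) ∂P = 0 := by
      have := (h.indepFun (hMF.mul (hθ n))).integral_fun_mul_eq_mul_integral
        (hMm.mul (hθ' n)).aestronglyMeasurable ham.aestronglyMeasurable
      simp only [Pi.mul_apply, h.integral_eq, mul_zero, mul_assoc] at this
      exact this
    have i3 : ∫ ω, (θ n ω * a n ω) ^ 2 ∂P = v * ∫ ω, θ n ω ^ 2 ∂P := by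
      have hind : IndepFun (fun ω => θ n ω ^ 2) (fun ω => a n ω ^ 2) P :=
        (h.indepFun (hθ n)).comp (φ := fun x => x ^ 2) (ψ := fun x => x ^ 2)
          (by fun_prop) (by fun_prop)
      simp_rw [mul_pow]
      rw [hind.integral_fun_mul_eq_mul_integral (by fun_prop) (by fun_prop), h.integral_sq,
        mul_comm]
    have hint := (hL n).integrable one_le_two
    have hMint := ih0.integrable one_le_two
    simp_rw [Finset.sum_range_succ]
    refine ⟨ih0.add (hL n), ?_, ?_⟩
    · rw [integral_add hMint hint, ih1, i1, add_zero]
    · have : ∀ ω, (M ω + θ n ω * a n ω) ^ 2 =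
          M ω ^ 2 + 2 * (M ω * (θ n ω * a n ω)) + (θ n ω * a n ω) ^ 2 := fun ω => by ring
      have j1 : Integrable (fun ω => M ω ^ 2) P := ih0.integrable_sq
      have j2 : Integrable (fun ω => 2 * (M ω * (θ n ω * a n ω))) P :=
        (ih0.integrable_mul (hL n)).const_mul 2
      have j3 : Integrable (fun ω => (θ n ω * a n ω) ^ 2) P := (hL n).integrable_sq
      change ∫ ω, (M ω + θ n ω * a n ω) ^ 2 ∂P = _
      simp_rw [this]
      have k1 := integral_add (j1.add j2) j3
      have k2 := integral_add j1 j2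
      simp only [Pi.add_apply] at k1 k2
      rw [k1, k2, integral_const_mul, i2, i3, ih2]
      ring

end IsGaussianInnovation

theorem integral_abs_le_sqrt [IsProbabilityMeasure P] {Z : Ω → ℝ} (hZ : MemLp Z 2 P) :
    ∫ ω, |Z ω| ∂P ≤ √(∫ ω, Z ω ^ 2 ∂P) := by
  apply Real.le_sqrt_of_sq_le
  have h1 := variance_nonneg |Z| P
  rw [variance_eq_sub hZ.abs] at h1
  simp only [Pi.pow_apply, Pi.abs_apply, sq_abs] at h1
  linarith

theorem integral_posPart_of_integral_eq_zero {Z : Ω → ℝ} (hZ : Integrable Z P)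
    (h0 : ∫ ω, Z ω ∂P = 0) : ∫ ω, max (Z ω) 0 ∂P = 1 / 2 * ∫ ω, |Z ω| ∂P := by
  have : ∀ ω, max (Z ω) 0 = 1 / 2 * (Z ω + |Z ω|) := fun ω => by
    rcases le_total 0 (Z ω) with h | h
    · rw [max_eq_left h, abs_of_nonneg h]; ring
    · rw [max_eq_right h, abs_of_nonpos h]; ring
  simp_rw [this]
  rw [integral_const_mul, integral_add hZ hZ.abs, h0, zero_add]

end Innovations

/-! ### From displacement to expected time: Wald-type bounds. -/

section Passage

variable {Ω : Type*} {mΩ : MeasurableSpace Ω} {P : Measure Ω} [IsProbabilityMeasure P]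
  {F : Filtration ℕ mΩ} {a b : ℕ → Ω → ℝ} {s l : ℝ} {v va vb w : NNReal}

namespace IsGaussianInnovation

theorem integrable_stopped_sum (h : IsGaussianInnovation P F a s v) {K : ℕ → Set Ω}
    (hKm : ∀ t, MeasurableSet[F t] (K t)) (n : ℕ) :
    Integrable (fun ω => ∑ i ∈ Finset.range n, (K i).indicator (a i) ω) P :=
  integrable_finsetSum _ fun i _ => (h.integrable i).indicator (F.le _ _ (hKm i))

theorem integrable_sum (h : IsGaussianInnovation P F a s v) (n : ℕ) :
    Integrable (fun ω => ∑ i ∈ Finset.range n, a i ω) P :=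
  integrable_finsetSum _ fun i _ => h.integrable i

/-- The expected time between `R` and a later crossing of the level `l`, where `{R > t} = K t`. -/
theorem mul_sum_prob_compl_inter_staysBelow_le (h : IsGaussianInnovation P F a s v) (hs : 0 ≤ s)
    (hv0 : 0 < v) (hv : v ≤ 1) {K : ℕ → Set Ω} (hK : Antitone K)
    (hKm : ∀ t, MeasurableSet[F t] (K t)) (n : ℕ) :
    s * ∑ t ∈ Finset.range n, P.real ((K t)ᶜ ∩ staysBelow a l t) ≤
      ∫ ω, (K n)ᶜ.indicator
        (fun ω => max (l - ∑ i ∈ Finset.range n, (K i).indicator (a i) ω) 0) ω ∂P + (s + 1) := by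
  have hHF : ∀ t, MeasurableSet[F t] ((K t)ᶜ ∩ staysBelow a l t) := fun t =>
    MeasurableSet.inter (MeasurableSet.compl (hKm t)) (h.measurableSet_staysBelow l t)
  have hH : ∀ t, MeasurableSet ((K t)ᶜ ∩ staysBelow a l t) := fun t => F.le _ _ (hHF t)
  have hG : ∀ t, MeasurableSet (staysBelow a l t) := fun t =>
    F.le _ _ (h.measurableSet_staysBelow l t)
  have hE : ∀ t, Integrable (fun ω => max (∑ j ∈ Finset.range (t + 1), a j ω - l) 0) P :=
    fun t => ((h.integrable_sum (t + 1)).sub (integrable_const l)).pos_part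
  have hterm : ∀ t, s * P.real ((K t)ᶜ ∩ staysBelow a l t)
      - (s + 1) * (P.real (staysBelow a l t) - P.real (staysBelow a l (t + 1))) ≤
      ∫ ω, ((K t)ᶜ ∩ staysBelow a l t).indicator
        (fun ω => a t ω - max (∑ j ∈ Finset.range (t + 1), a j ω - l) 0) ω ∂P := by
    intro t
    have e1 : ∀ ω, ((K t)ᶜ ∩ staysBelow a l t).indicator
        (fun ω => a t ω - max (∑ j ∈ Finset.range (t + 1), a j ω - l) 0) ω =
        ((K t)ᶜ ∩ staysBelow a l t).indicator (a t) ω -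
        ((K t)ᶜ ∩ staysBelow a l t).indicator
          (fun ω => max (a t ω - (l - ∑ j ∈ Finset.range t, a j ω)) 0) ω := fun ω => by
      by_cases hω : ω ∈ (K t)ᶜ ∩ staysBelow a l t
      · simp only [Set.indicator_of_mem hω, Finset.sum_range_succ]
        congr 2; ring
      · simp only [Set.indicator_of_notMem hω, sub_zero]
    have hEt : Integrable (fun ω => max (a t ω - (l - ∑ j ∈ Finset.range t, a j ω)) 0) P :=
      ((h.integrable t).sub ((integrable_const l).sub (h.integrable_sum t))).pos_part
    have e2 := h.integral_indicator_excess_le hs hv0 hv (hHF t)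
      (c := fun ω => l - ∑ j ∈ Finset.range t, a j ω)
      ((@measurable_const _ _ _ (F t) l).sub (h.measurable_sum t))
      (fun ω hω => sub_pos.2 (hω.2 t le_rfl))
    -- An overshoot at step `t + 1` requires a first crossing there. These probabilities telescope,
    -- so all overshoots together cost at most `s + 1`.
    have e3 : P.real ((K t)ᶜ ∩ staysBelow a l t ∩ {ω | l - ∑ j ∈ Finset.range t, a j ω ≤ a t ω}) ≤
        P.real (staysBelow a l t) - P.real (staysBelow a l (t + 1)) := by
      rw [← measureReal_sdiff (staysBelow_antitone t.le_succ) (hG _)]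
      refine measureReal_mono ?_
      rintro ω ⟨⟨-, h1⟩, h2⟩
      refine ⟨h1, fun h3 => ?_⟩
      have h4 := (mem_staysBelow_succ.1 h3).2
      rw [Finset.sum_range_succ] at h4
      have h5 : l - ∑ j ∈ Finset.range t, a j ω ≤ a t ω := h2
      linarith
    simp_rw [e1]
    rw [integral_sub ((h.integrable t).indicator (hH t)) (hEt.indicator (hH t)),
      h.integral_indicator (hHF t)]
    have := mul_le_mul_of_nonneg_left e3 (show 0 ≤ s + 1 by linarith)
    linarith
  have hsum : s * ∑ t ∈ Finset.range n, P.real ((K t)ᶜ ∩ staysBelow a l t)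
      - (s + 1) * (P.real (staysBelow a l 0) - P.real (staysBelow a l n)) ≤
      ∫ ω, (K n)ᶜ.indicator
        (fun ω => max (l - ∑ i ∈ Finset.range n, (K i).indicator (a i) ω) 0) ω ∂P := by
    rw [← Finset.sum_range_sub' (fun t => P.real (staysBelow a l t)), Finset.mul_sum,
      Finset.mul_sum, ← Finset.sum_sub_distrib]
    refine (Finset.sum_le_sum fun t _ => hterm t).trans ?_
    have hi : ∀ t, Integrable (((K t)ᶜ ∩ staysBelow a l t).indicator
        (fun ω => a t ω - max (∑ j ∈ Finset.range (t + 1), a j ω - l) 0)) P := fun t =>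
      ((h.integrable t).sub (hE t)).indicator (hH t)
    rw [← integral_finsetSum _ fun t _ => hi t]
    refine integral_mono (integrable_finsetSum _ fun t _ => hi t) ?_
      (sum_indicator_compl_inter_staysBelow_le hK n)
    exact (((integrable_const l).sub (h.integrable_stopped_sum hKm n)).pos_part).indicator
      (F.le _ _ (hKm n)).compl
  have h1 : P.real (staysBelow a l 0) ≤ 1 := measureReal_le_one
  have h2 : 0 ≤ P.real (staysBelow a l n) := measureReal_nonneg
  nlinarith

/-- Wald's bound for the expected crossing time. -/
theorem mul_sum_prob_staysBelow_le (h : IsGaussianInnovation P F a s v) (hs : 0 ≤ s)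
    (hl : 0 ≤ l) (hv0 : 0 < v) (hv : v ≤ 1) (n : ℕ) :
    s * ∑ t ∈ Finset.range n, P.real (staysBelow a l t) ≤ l + (s + 1) := by
  -- Empty `K` means `R = 0`: the whole distance `l` is still to be covered.
  have := h.mul_sum_prob_compl_inter_staysBelow_le (l := l) hs hv0 hv (K := fun _ => ∅)
    antitone_const (fun t => @MeasurableSet.empty _ (F t)) n
  simpa [hl] using this

/-- Each step after the crossing has conditional mean `s`, and these steps start from a height at
least `l`, so their sum is at most the final excess over `l`. -/
theorem mul_sum_prob_compl_staysBelow_le (h : IsGaussianInnovation P F a s v) (hl : 0 < l)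
    (n : ℕ) :
    s * ∑ t ∈ Finset.range n, P.real (staysBelow a l t)ᶜ ≤
      ∫ ω, max (∑ j ∈ Finset.range n, a j ω - l) 0 ∂P := by
  have hG : ∀ t, MeasurableSet[F t] (staysBelow a l t)ᶜ := fun t =>
    MeasurableSet.compl (h.measurableSet_staysBelow l t)
  have hi : ∀ t, Integrable ((staysBelow a l t)ᶜ.indicator (a t)) P := fun t =>
    (h.integrable t).indicator (F.le _ _ (hG t))
  rw [Finset.mul_sum]
  simp_rw [← h.integral_indicator (hG _)]
  rw [← integral_finsetSum _ fun t _ => hi t]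
  exact integral_mono (integrable_finsetSum _ fun t _ => hi t)
    ((h.integrable_sum n).sub (integrable_const l)).pos_part
    (sum_indicator_compl_staysBelow_le hl n)

theorem integral_abs_sum_sub_le (h : IsGaussianInnovation P F a s v) (hv : v ≤ 1) (N : ℕ) :
    ∫ ω, |∑ j ∈ Finset.range N, a j ω - l| ∂P ≤ √N + |s * N - l| := by
  obtain ⟨hM, -, hM2⟩ := h.sub_const.moments_transform (θ := fun _ _ => 1)
    (fun i => @measurable_const _ _ _ (F i) 1) (fun _ _ => by simp) N
  simp only [one_mul, one_pow, integral_const, probReal_univ, smul_eq_mul, mul_one,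
    Finset.sum_const, Finset.card_range, nsmul_eq_mul] at hM hM2
  have h1 := integral_abs_le_sqrt hM
  rw [hM2] at h1
  have h2 : √(v * N) ≤ √(N : ℝ) :=
    Real.sqrt_le_sqrt (mul_le_of_le_one_left (Nat.cast_nonneg N) (by exact_mod_cast hv))
  have hMi := (hM.integrable one_le_two).abs
  calc ∫ ω, |∑ j ∈ Finset.range N, a j ω - l| ∂P
      ≤ ∫ ω, (|∑ j ∈ Finset.range N, (a j ω - s)| + |s * N - l|) ∂P := by
        refine integral_mono ((h.integrable_sum N).sub (integrable_const l)).abs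
          (hMi.add (integrable_const _)) fun ω => ?_
        refine le_trans (le_of_eq ?_) (abs_add_le _ _)
        simp only [Finset.sum_sub_distrib, Finset.sum_const, Finset.card_range, nsmul_eq_mul]
        congr 1; ring
    _ = ∫ ω, |∑ j ∈ Finset.range N, (a j ω - s)| ∂P + |s * N - l| := by
        rw [integral_add hMi (integrable_const _)]; simp
    _ ≤ _ := by linarith

/-- The expected distance between the crossing time and `⌊l / s⌋`. -/
theorem sum_prob_discrepancy_le (h : IsGaussianInnovation P F a s v) (hs : 0 < s) (hl : 0 < l)
    (hv0 : 0 < v) (hv : v ≤ 1) {n : ℕ} (hn : ⌊l / s⌋₊ ≤ n) :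
    ∑ t ∈ Finset.range ⌊l / s⌋₊, P.real (staysBelow a l t)ᶜ +
      ∑ t ∈ Finset.Ico ⌊l / s⌋₊ n, P.real (staysBelow a l t) ≤ √(l / s) / s + 2 + 1 / s := by
  set N := ⌊l / s⌋₊ with hN
  have hNle : (N : ℝ) ≤ l / s := Nat.floor_le (by positivity)
  have hNlt : l / s < N + 1 := Nat.lt_floor_add_one _
  have hsN : |s * N - l| ≤ s := by
    rw [le_div_iff₀ hs] at hNle
    rw [div_lt_iff₀ hs] at hNlt
    rw [abs_le]; constructor <;> nlinarith
  have h1 := h.mul_sum_prob_compl_staysBelow_le hl N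
  -- This `K` encodes the deterministic time `R = N`, so the stopped sum is the walk at time `N`.
  -- The bounds for early and late crossing then involve the two signed parts of the walk at `N`
  -- minus `l`, which add up to its absolute value.
  have h2 := h.mul_sum_prob_compl_inter_staysBelow_le (l := l) hs.le hv0 hv
    (K := fun t => if t < N then Set.univ else ∅)
    (fun i j hij => by
      dsimp only
      split_ifs with hj hi
      · exact le_rfl
      · omega
      · exact Set.empty_subset _
      · exact le_rfl)
    (fun t => by
      split_ifs
      · exact @MeasurableSet.univ _ (F t)
      · exact @MeasurableSet.empty _ (F t)) n
  have e1 : ∑ t ∈ Finset.range n, P.real ((if t < N then Set.univ else ∅)ᶜ ∩ staysBelow a l t) =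
      ∑ t ∈ Finset.Ico N n, P.real (staysBelow a l t) := by
    rw [← Finset.sum_range_add_sum_Ico _ hn, Finset.sum_eq_zero, zero_add]
    · refine Finset.sum_congr rfl fun t ht => ?_
      rw [if_neg (not_lt.2 (Finset.mem_Ico.1 ht).1), Set.compl_empty, Set.univ_inter]
    · intro t ht
      rw [if_pos (Finset.mem_range.1 ht), Set.compl_univ, Set.empty_inter, measureReal_empty]
  have e2 : ∀ ω, ∑ i ∈ Finset.range n, (if i < N then Set.univ else ∅ : Set Ω).indicator (a i) ω =
      ∑ i ∈ Finset.range N, a i ω := fun ω => by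
    rw [← Finset.sum_range_add_sum_Ico _ hn, Finset.sum_eq_zero (s := Finset.Ico N n), add_zero]
    · refine Finset.sum_congr rfl fun t ht => ?_
      rw [if_pos (Finset.mem_range.1 ht), Set.indicator_univ]
    · intro t ht
      rw [if_neg (not_lt.2 (Finset.mem_Ico.1 ht).1), Set.indicator_empty]
  simp only [e1, e2, if_neg (not_lt.2 hn), Set.compl_empty, Set.indicator_univ] at h2
  have i1 := ((h.integrable_sum N).sub (integrable_const l)).pos_part
  have i2 := ((integrable_const l).sub (h.integrable_sum N)).pos_part
  have h3 := integral_add i1 i2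
  have h4 : ∀ ω, max (∑ j ∈ Finset.range N, a j ω - l) 0 + max (l - ∑ j ∈ Finset.range N, a j ω) 0
      = |∑ j ∈ Finset.range N, a j ω - l| := fun ω => by
    rcases le_total l (∑ j ∈ Finset.range N, a j ω) with hc | hc
    · rw [max_eq_left (by linarith), max_eq_right (by linarith), abs_of_nonneg (by linarith),
        add_zero]
    · rw [max_eq_right (by linarith), max_eq_left (by linarith), abs_of_nonpos (by linarith)]
      ring
  simp only [Pi.sub_apply, h4] at h3
  have h5 := h.integral_abs_sum_sub_le (l := l) hv N
  have h6 : √(N : ℝ) ≤ √(l / s) := Real.sqrt_le_sqrt hNle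
  have : √(l / s) / s + 2 + 1 / s = (√(l / s) + s + (s + 1)) / s := by field_simp; ring
  rw [this, le_div_iff₀ hs]
  linarith

/-- The expected time by which the crossing for `a` comes after the crossing for `b`. -/
theorem mul_sum_prob_between_le (ha : IsGaussianInnovation P F a s va)
    (hb : IsGaussianInnovation P F b s vb)
    (hd : IsGaussianInnovation P F (fun i ω => b i ω - a i ω) 0 w) (hs : 0 < s) (hl : 0 < l)
    (hva0 : 0 < va) (hva : va ≤ 1) (hvb0 : 0 < vb) (hvb : vb ≤ 1) (hw : w ≤ 1) (n : ℕ) :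
    s * ∑ t ∈ Finset.range n, P.real ((staysBelow b l t)ᶜ ∩ staysBelow a l t) ≤
      √(l / s * w) / √(2 * Real.pi) + 1 / 2 * √(√(l / s) / s + 2 + 1 / s) + (s + 1) := by
  set N := ⌊l / s⌋₊ with hN
  have hNle : (N : ℝ) ≤ l / s := Nat.floor_le (by positivity)
  -- The left side increases with `n` and the right side does not depend on it.
  wlog hn : N ≤ n generalizing n
  · refine le_trans (mul_le_mul_of_nonneg_left ?_ hs.le) (this N le_rfl)
    exact Finset.sum_le_sum_of_subset_of_nonneg
      (Finset.range_subset_range.2 (not_le.1 hn).le) fun _ _ _ => measureReal_nonneg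
  have hKm : ∀ t, MeasurableSet[F t] (staysBelow b l t) := hb.measurableSet_staysBelow l
  have hKm' : ∀ t, MeasurableSet (staysBelow b l t) := fun t => F.le _ _ (hKm t)
  have h1 := ha.mul_sum_prob_compl_inter_staysBelow_le (l := l) hs.le hva0 hva
    staysBelow_antitone hKm n
  set d : ℕ → Ω → ℝ := fun i ω => b i ω - a i ω with hddef
  -- With `σ` the crossing time for `b`, `θ i` is the indicator of `i < σ` minus that of `i < N`.
  -- Its transform of `d` is `D` at `min σ n` minus `D_N`, and the sum of `θ i ^ 2` counts the times
  -- between `min σ n` and `N`.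
  set θ : ℕ → Ω → ℝ := fun i ω =>
    (staysBelow b l i).indicator (fun _ => 1) ω - if i < N then 1 else 0 with hθ
  have hθm : ∀ i, Measurable[F i] (θ i) := fun i =>
    ((@measurable_const _ _ _ (F i) 1).indicator (hKm i)).sub_const _
  have hθb : ∀ i ω, |θ i ω| ≤ 1 := fun i ω => by
    simp only [hθ, Set.indicator]
    split_ifs <;> norm_num
  obtain ⟨hM, hM1, hM2⟩ := hd.moments_transform hθm hθb n
  have hsq : ∑ i ∈ Finset.range n, ∫ ω, θ i ω ^ 2 ∂P ≤ √(l / s) / s + 2 + 1 / s := by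
    refine le_trans (le_of_eq ?_) (hb.sum_prob_discrepancy_le hs hl hvb0 hvb hn)
    rw [← Finset.sum_range_add_sum_Ico _ hn]
    congr 1
    · refine Finset.sum_congr rfl fun i hi => ?_
      have hi' : i < N := Finset.mem_range.1 hi
      rw [← integral_indicator_one (hKm' i).compl]
      congr 1; ext ω
      by_cases hω : ω ∈ staysBelow b l i <;> simp [hθ, hω, hi']
    · refine Finset.sum_congr rfl fun i hi => ?_
      have hi' : ¬i < N := not_lt.2 (Finset.mem_Ico.1 hi).1
      rw [← integral_indicator_one (hKm' i)]
      congr 1; ext ω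
      by_cases hω : ω ∈ staysBelow b l i <;> simp [hθ, hω, hi']
  have hMpos : ∫ ω, max (∑ i ∈ Finset.range n, θ i ω * d i ω) 0 ∂P ≤
      1 / 2 * √(√(l / s) / s + 2 + 1 / s) := by
    -- The transform is centred, so its positive part carries half of its absolute mean; this is the
    -- source of the factor `1 / 2`.
    rw [integral_posPart_of_integral_eq_zero (hM.integrable one_le_two) hM1]
    refine mul_le_mul_of_nonneg_left ((integral_abs_le_sqrt hM).trans ?_) (by norm_num)
    rw [hM2]
    refine Real.sqrt_le_sqrt (le_trans (mul_le_of_le_one_left ?_ (by exact_mod_cast hw)) hsq)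
    exact Finset.sum_nonneg fun i _ => integral_nonneg fun ω => sq_nonneg _
  have hDN : ∫ ω, max (∑ i ∈ Finset.range N, d i ω) 0 ∂P ≤ √(l / s * w) / √(2 * Real.pi) := by
    rw [hd.integral_posPart_sum]
    gcongr
  have i1 : Integrable (fun ω => max (∑ i ∈ Finset.range N, d i ω) 0) P :=
    (hd.integrable_sum N).pos_part
  have i2 : Integrable (fun ω => max (∑ i ∈ Finset.range n, θ i ω * d i ω) 0) P :=
    (hM.integrable one_le_two).pos_part
  have hle : ∫ ω, (staysBelow b l n)ᶜ.indicator (fun ω => max (l - ∑ i ∈ Finset.range n,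
        (staysBelow b l i).indicator (a i) ω) 0) ω ∂P ≤
      ∫ ω, (max (∑ i ∈ Finset.range N, d i ω) 0
        + max (∑ i ∈ Finset.range n, θ i ω * d i ω) 0) ∂P := by
    refine integral_mono ((((integrable_const l).sub
      (ha.integrable_stopped_sum hKm n)).pos_part).indicator (hKm' n).compl) (i1.add i2) fun ω => ?_
    have hnn : 0 ≤ max (∑ i ∈ Finset.range N, d i ω) 0
        + max (∑ i ∈ Finset.range n, θ i ω * d i ω) 0 :=
      add_nonneg (le_max_right _ _) (le_max_right _ _)
    by_cases hω : ω ∈ staysBelow b l n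
    · rw [Set.indicator_of_notMem (Set.notMem_compl_iff.2 hω)]
      exact hnn
    · rw [Set.indicator_of_mem hω]
      refine max_le ?_ hnn
      have hcross := le_stopped_sum hl hω
      have hsplit : ∑ i ∈ Finset.range n, (staysBelow b l i).indicator (b i) ω -
          ∑ i ∈ Finset.range n, (staysBelow b l i).indicator (a i) ω =
          ∑ i ∈ Finset.range N, d i ω + ∑ i ∈ Finset.range n, θ i ω * d i ω := by
        have hr : ∑ i ∈ Finset.range N, d i ω =
            ∑ i ∈ Finset.range n, (if i < N then 1 else 0) * d i ω := by
          rw [← Finset.sum_range_add_sum_Ico _ hn, Finset.sum_eq_zero (s := Finset.Ico N n),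
            add_zero]
          · exact Finset.sum_congr rfl fun i hi => by rw [if_pos (Finset.mem_range.1 hi), one_mul]
          · intro i hi
            rw [if_neg (not_lt.2 (Finset.mem_Ico.1 hi).1), zero_mul]
        rw [hr, ← Finset.sum_sub_distrib, ← Finset.sum_add_distrib]
        refine Finset.sum_congr rfl fun i _ => ?_
        by_cases hi : ω ∈ staysBelow b l i
        · simp only [hθ, hddef, Set.indicator_of_mem hi]
          ring
        · simp [hθ, hddef, hi]
      linarith [le_max_left (∑ i ∈ Finset.range N, d i ω) 0,
        le_max_left (∑ i ∈ Finset.range n, θ i ω * d i ω) 0]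
  rw [integral_add i1 i2] at hle
  linarith

end IsGaussianInnovation

end Passage

/-! ### From tail sums to random times. -/

section Times

variable {Ω : Type*} {mΩ : MeasurableSpace Ω} {P : Measure Ω} [IsProbabilityMeasure P]
  {σ ρ : Ω → WithTop ℕ}

/-- Every term of the sum is at least the probability of `σ = ⊤`, so `n` times that probability
stays bounded. -/
theorem ae_ne_top_of_sum_prob_le {C : ℝ}
    (hC : ∀ n, ∑ t ∈ Finset.range n, P.real {ω | (t : WithTop ℕ) < σ ω} ≤ C) :
    ∀ᵐ ω ∂P, σ ω ≠ ⊤ := by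
  have h1 : ∀ n : ℕ, n * P.real {ω | σ ω = ⊤} ≤ C := fun n => by
    refine le_trans ?_ (hC n)
    rw [← nsmul_eq_mul, ← Finset.card_range n, ← Finset.sum_const, Finset.card_range]
    refine Finset.sum_le_sum fun t _ => measureReal_mono fun ω (hω : σ ω = ⊤) => ?_
    simp only [Set.mem_ofPred_eq, hω]
    exact WithTop.coe_lt_top t
  have h2 : P.real {ω | σ ω = ⊤} = 0 := by
    by_contra hne
    have hpos : 0 < P.real {ω | σ ω = ⊤} := lt_of_le_of_ne measureReal_nonneg (Ne.symm hne)
    obtain ⟨n, hn⟩ := exists_nat_gt (C / P.real {ω | σ ω = ⊤})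
    rw [div_lt_iff₀ hpos] at hn
    exact absurd (h1 n) (not_le.2 hn)
  rw [ae_iff]
  simpa using (measureReal_eq_zero_iff).1 h2

theorem tsum_indicator_Ico (x y : ℕ) :
    ∑' t : ℕ, (Set.Ico x y).indicator (1 : ℕ → ENNReal) t = ((y - x : ℕ) : ENNReal) := by
  have h1 : ∀ t ∉ Finset.Ico x y, (Set.Ico x y).indicator (1 : ℕ → ENNReal) t = 0 :=
    fun t ht => Set.indicator_of_notMem (by simpa using ht) _
  have h2 : ∀ t ∈ Finset.Ico x y, (Set.Ico x y).indicator (1 : ℕ → ENNReal) t = 1 :=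
    fun t ht => Set.indicator_of_mem (by simpa using ht) _
  rw [tsum_eq_sum h1, Finset.sum_congr rfl h2]
  simp

/-- Layer-cake bound for the mean absolute difference of two almost surely finite times. -/
theorem integral_abs_timeReal_sub_le
    (hσm : ∀ t : ℕ, MeasurableSet {ω | (t : WithTop ℕ) < σ ω})
    (hρm : ∀ t : ℕ, MeasurableSet {ω | (t : WithTop ℕ) < ρ ω})
    (hσ : ∀ᵐ ω ∂P, σ ω ≠ ⊤) (hρ : ∀ᵐ ω ∂P, ρ ω ≠ ⊤) {C : ℝ}
    (hC : ∀ n, ∑ t ∈ Finset.range n,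
      (P.real ({ω | (t : WithTop ℕ) < σ ω}ᶜ ∩ {ω | (t : WithTop ℕ) < ρ ω}) +
        P.real ({ω | (t : WithTop ℕ) < ρ ω}ᶜ ∩ {ω | (t : WithTop ℕ) < σ ω})) ≤ C) :
    Integrable (fun ω => |timeReal (σ ω) - timeReal (ρ ω)|) P ∧
      ∫ ω, |timeReal (σ ω) - timeReal (ρ ω)| ∂P ≤ C := by
  set A : ℕ → Set Ω := fun t => {ω | (t : WithTop ℕ) < σ ω}ᶜ ∩ {ω | (t : WithTop ℕ) < ρ ω} with hA
  set B : ℕ → Set Ω := fun t => {ω | (t : WithTop ℕ) < ρ ω}ᶜ ∩ {ω | (t : WithTop ℕ) < σ ω} with hB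
  have hAm : ∀ t, MeasurableSet (A t) := fun t => (hσm t).compl.inter (hρm t)
  have hBm : ∀ t, MeasurableSet (B t) := fun t => (hρm t).compl.inter (hσm t)
  set g : Ω → ENNReal := fun ω => ∑' t, ((A t).indicator 1 ω + (B t).indicator 1 ω) with hg
  have hgm : Measurable g := Measurable.tsum fun t =>
    (measurable_one.indicator (hAm t)).add (measurable_one.indicator (hBm t))
  have hgl : ∫⁻ ω, g ω ∂P ≤ ENNReal.ofReal C := by
    have hsum := lintegral_tsum (μ := P) fun t =>
      ((measurable_one.indicator (hAm t)).add (measurable_one.indicator (hBm t))).aemeasurable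
    simp only [Pi.add_apply] at hsum
    rw [hg, hsum]
    refine ENNReal.tsum_le_of_sum_range_le fun n => ?_
    refine le_trans (le_of_eq ?_) (ENNReal.ofReal_le_ofReal (hC n))
    rw [ENNReal.ofReal_sum_of_nonneg fun t _ => add_nonneg measureReal_nonneg measureReal_nonneg]
    refine Finset.sum_congr rfl fun t _ => ?_
    rw [lintegral_add_left (measurable_one.indicator (hAm t)),
      lintegral_indicator_one (hAm t), lintegral_indicator_one (hBm t),
      ENNReal.ofReal_add measureReal_nonneg measureReal_nonneg, ofReal_measureReal,
      ofReal_measureReal]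
  -- For finite times `x`, `y` the distance counts the integers in `[x, y)` and `[y, x)`. The value
  -- that `timeReal` gives to `⊤` only matters on a null set.
  have heq : (fun ω => |timeReal (σ ω) - timeReal (ρ ω)|) =ᵐ[P] fun ω => (g ω).toReal := by
    filter_upwards [hσ, hρ] with ω h1 h2
    obtain ⟨x, hx⟩ := WithTop.ne_top_iff_exists.1 h1
    obtain ⟨y, hy⟩ := WithTop.ne_top_iff_exists.1 h2
    have hAi : ∀ t, (A t).indicator (1 : Ω → ENNReal) ω = (Set.Ico x y).indicator 1 t := fun t => by
      simp [Set.indicator, hA, ← hx, ← hy]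
    have hBi : ∀ t, (B t).indicator (1 : Ω → ENNReal) ω = (Set.Ico y x).indicator 1 t := fun t => by
      simp [Set.indicator, hB, ← hx, ← hy]
    simp only [hg, hAi, hBi]
    rw [ENNReal.tsum_add, tsum_indicator_Ico, tsum_indicator_Ico, ← Nat.cast_add,
      ENNReal.toReal_natCast, ← hx, ← hy]
    simp only [timeReal, WithTop.untopD_coe]
    rcases le_total x y with h | h
    · rw [Nat.sub_eq_zero_of_le h, add_zero, Nat.cast_sub h, abs_sub_comm, abs_of_nonneg]
      exact sub_nonneg.2 (by exact_mod_cast h)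
    · rw [Nat.sub_eq_zero_of_le h, zero_add, Nat.cast_sub h, abs_of_nonneg]
      exact sub_nonneg.2 (by exact_mod_cast h)
  have hfin : ∫⁻ ω, g ω ∂P ≠ ⊤ := ne_top_of_le_ne_top ENNReal.ofReal_ne_top hgl
  refine ⟨(integrable_toReal_of_lintegral_ne_top hgm.aemeasurable hfin).congr heq.symm, ?_⟩
  rw [integral_congr_ae heq, integral_toReal hgm.aemeasurable (ae_lt_top hgm hfin)]
  exact ENNReal.toReal_le_of_le_ofReal (by simpa using hC 0) hgl

end Times

/-! ### The concrete walks and the numerical constant. -/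

section Walks

variable {Ω : Type*} [mΩ : MeasurableSpace Ω]

/-- The filtration generated by the increments `V i`, `W i` with `i < t`. -/
def incrementFiltration {V W : ℕ → Ω → ℝ} (hV : ∀ i, Measurable (V i))
    (hW : ∀ i, Measurable (W i)) : Filtration ℕ mΩ where
  seq t := ⨆ j ∈ {j : ℕ ⊕ ℕ | Sum.elim id id j < t},
    MeasurableSpace.comap (Sum.elim V W j) inferInstance
  mono' _ _ hij := biSup_mono fun _ h => lt_of_lt_of_le h hij
  le' _ := iSup₂_le fun j _ => by
    rcases j with j | j
    · exact (hV j).comap_le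
    · exact (hW j).comap_le

/-- Treats `X`, its estimate and their differences uniformly. Independence from the past holds
because the variables with index below `i` and those with index `i` form disjoint blocks of one
independent family. -/
theorem isGaussianInnovation_linear_combination {P : Measure Ω} [IsProbabilityMeasure P]
    {V W : ℕ → Ω → ℝ} (hV : ∀ i, Measurable (V i)) (hW : ∀ i, Measurable (W i))
    (hVlaw : ∀ i, HasLaw (V i) (gaussianReal 0 1) P)
    (hWlaw : ∀ i, HasLaw (W i) (gaussianReal 0 1) P)
    (hindep : iIndepFun (Sum.elim V W) P) (s α β : ℝ) {v : NNReal} (hv : (v : ℝ) = α ^ 2 + β ^ 2) :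
    IsGaussianInnovation P (incrementFiltration hV hW)
      (fun i ω => s + (α * V i ω + β * W i ω)) s v where
  measurable_succ i := by
    have h1 : Measurable[incrementFiltration hV hW (i + 1)] (V i) :=
      Measurable.of_comap_le
        (le_iSup₂_of_le (f := fun (j : ℕ ⊕ ℕ) (_ : j ∈ {j : ℕ ⊕ ℕ | Sum.elim id id j < i + 1}) =>
          MeasurableSpace.comap (Sum.elim V W j) inferInstance) (Sum.inl i) (Nat.lt_succ_self i)
          le_rfl)
    have h2 : Measurable[incrementFiltration hV hW (i + 1)] (W i) :=
      Measurable.of_comap_le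
        (le_iSup₂_of_le (f := fun (j : ℕ ⊕ ℕ) (_ : j ∈ {j : ℕ ⊕ ℕ | Sum.elim id id j < i + 1}) =>
          MeasurableSpace.comap (Sum.elim V W j) inferInstance) (Sum.inr i) (Nat.lt_succ_self i)
          le_rfl)
    exact ((h1.const_mul α).add (h2.const_mul β)).const_add s
  indep i := by
    have hle : ∀ j, MeasurableSpace.comap (Sum.elim V W j) inferInstance ≤ mΩ := by
      rintro (j | j)
      · exact (hV j).comap_le
      · exact (hW j).comap_le
    have hdisj : Disjoint {j : ℕ ⊕ ℕ | Sum.elim id id j < i} {j | Sum.elim id id j = i} :=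
      Set.disjoint_left.2 fun j h1 h2 => absurd h1 (not_lt.2 (le_of_eq (Eq.symm h2)))
    refine indep_of_indep_of_le_right (indep_iSup_of_disjoint hle hindep hdisj) ?_
    have h1 : Measurable[⨆ j ∈ {j : ℕ ⊕ ℕ | Sum.elim id id j = i},
        MeasurableSpace.comap (Sum.elim V W j) inferInstance] (V i) :=
      Measurable.of_comap_le
        (le_iSup₂_of_le (f := fun (j : ℕ ⊕ ℕ) (_ : j ∈ {j : ℕ ⊕ ℕ | Sum.elim id id j = i}) =>
          MeasurableSpace.comap (Sum.elim V W j) inferInstance) (Sum.inl i) rfl le_rfl)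
    have h2 : Measurable[⨆ j ∈ {j : ℕ ⊕ ℕ | Sum.elim id id j = i},
        MeasurableSpace.comap (Sum.elim V W j) inferInstance] (W i) :=
      Measurable.of_comap_le
        (le_iSup₂_of_le (f := fun (j : ℕ ⊕ ℕ) (_ : j ∈ {j : ℕ ⊕ ℕ | Sum.elim id id j = i}) =>
          MeasurableSpace.comap (Sum.elim V W j) inferInstance) (Sum.inr i) rfl le_rfl)
    exact (((h1.const_mul α).add (h2.const_mul β)).const_add s).comap_le
  law i := by
    have hind : IndepFun (V i) (W i) P := hindep.indepFun (i := Sum.inl i) (j := Sum.inr i) (by simp)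
    have h1 := (hind.comp (φ := fun x => α * x) (ψ := fun x => β * x) (by fun_prop)
      (by fun_prop)).hasLaw_fun_add (gaussianReal_const_mul (hVlaw i) α)
        (gaussianReal_const_mul (hWlaw i) β)
    rw [gaussianReal_conv_gaussianReal] at h1
    have h2 := gaussianReal_const_add h1 s
    convert h2 using 2
    · simp
    · ext; simp [hv]

theorem staysBelow_eq_lt_crossingTime {Ω : Type*} {Z a : ℕ → Ω → ℝ}
    (hZ : ∀ t ω, Z t ω = ∑ i ∈ Finset.range t, a i ω) (l : ℝ) (t : ℕ) :
    staysBelow a l t = {ω | (t : WithTop ℕ) < crossingTime Z l ω} := by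
  ext ω
  have h : crossingTime Z l ω ≤ (t : WithTop ℕ) ↔ ∃ j ∈ Set.Icc 0 t, Z j ω ∈ Set.Ici l :=
    hittingAfter_le_iff
  rw [Set.mem_ofPred_eq, ← not_le, h]
  simp [staysBelow, ← hZ]

/-- Subadditivity of the square root splits the correction into three terms. The first summand
matches the leading term exactly, and the rest is absorbed with room to spare. -/
theorem tracking_constant_le {ε s l : ℝ} (hs : 0 < s) (hl : 0 < l) :
    2 / s * (√(l / s * (ε ^ 2 / (1 + ε ^ 2))) / √(2 * Real.pi)
      + 1 / 2 * √(√(l / s) / s + 2 + 1 / s) + (s + 1)) ≤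
      √(2 * l * ε ^ 2 / (Real.pi * (1 + ε ^ 2) * s ^ 3))
        + 6 / s * (l / (2 * Real.pi * s) ^ 3) ^ (1 / 4 : ℝ)
        + √(8 * (s + 2) / (Real.pi * s ^ 3)) + 10 + 20 / s := by
  have hπ := Real.pi_pos
  have hπ4 := Real.pi_le_four
  have e1 : 2 / s * (√(l / s * (ε ^ 2 / (1 + ε ^ 2))) / √(2 * Real.pi)) =
      √(2 * l * ε ^ 2 / (Real.pi * (1 + ε ^ 2) * s ^ 3)) := by
    rw [← Real.sqrt_div' _ (by positivity), ← Real.sqrt_sq (show 0 ≤ 2 / s by positivity),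
      ← Real.sqrt_mul (by positivity)]
    congr 1
    field_simp
  have e2 : √(√(l / s) / s) ≤ 6 * (l / (2 * Real.pi * s) ^ 3) ^ (1 / 4 : ℝ) := by
    have hz : 0 ≤ l / (2 * Real.pi * s) ^ 3 := by positivity
    have h4 : (l / (2 * Real.pi * s) ^ 3) ^ (1 / 4 : ℝ) = √√(l / (2 * Real.pi * s) ^ 3) := by
      rw [Real.sqrt_eq_rpow, Real.sqrt_eq_rpow, ← Real.rpow_mul hz]
      norm_num
    rw [h4]
    apply Real.sqrt_le_iff.2 ⟨by positivity, ?_⟩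
    rw [mul_pow, Real.sq_sqrt (Real.sqrt_nonneg _), div_le_iff₀ hs]
    apply Real.sqrt_le_iff.2 ⟨by positivity, ?_⟩
    rw [mul_pow, mul_pow, Real.sq_sqrt hz]
    -- The bound `1296 = 6 ^ 4` is the coefficient `6` after squaring twice.
    have hp3 : (2 * Real.pi) ^ 3 ≤ 1296 := by
      have : Real.pi ^ 3 ≤ 4 ^ 3 := by gcongr
      nlinarith
    have : (6 ^ 2) ^ 2 * (l / (2 * Real.pi * s) ^ 3) * s ^ 2 = 1296 / (2 * Real.pi) ^ 3 * (l / s) := by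
      rw [mul_pow (2 * Real.pi)]
      field_simp
      norm_num
    rw [this]
    exact le_mul_of_one_le_left (by positivity) ((one_le_div (by positivity)).2 hp3)
  have e3 : 1 / s * √(1 / s) ≤ √(8 * (s + 2) / (Real.pi * s ^ 3)) := by
    apply Real.le_sqrt_of_sq_le
    rw [mul_pow, Real.sq_sqrt (by positivity)]
    have : (1 / s) ^ 2 * (1 / s) = 1 / s ^ 3 := by field_simp
    rw [this, div_le_div_iff₀ (by positivity) (by positivity)]
    have : 0 < s ^ 3 := by positivity
    nlinarith
  have e4 : √(√(l / s) / s + 2 + 1 / s) ≤ √(√(l / s) / s) + 2 + √(1 / s) := by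
    have h1 := Real.sqrt_nonneg (√(l / s) / s)
    have h2 := Real.sqrt_nonneg (1 / s)
    apply Real.sqrt_le_iff.2 ⟨by positivity, ?_⟩
    have h3 := Real.sq_sqrt (show 0 ≤ √(l / s) / s by positivity)
    have h4 := Real.sq_sqrt (show 0 ≤ 1 / s by positivity)
    nlinarith [mul_nonneg h1 h2]
  have hinv : 0 < 1 / s := by positivity
  calc _ = 2 / s * (√(l / s * (ε ^ 2 / (1 + ε ^ 2))) / √(2 * Real.pi))
        + 1 / s * √(√(l / s) / s + 2 + 1 / s) + (2 + 2 * (1 / s)) := by field_simp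
    _ ≤ √(2 * l * ε ^ 2 / (Real.pi * (1 + ε ^ 2) * s ^ 3))
        + 1 / s * (6 * (l / (2 * Real.pi * s) ^ 3) ^ (1 / 4 : ℝ) + 2 + √(1 / s))
        + (2 + 2 * (1 / s)) := by
        rw [e1]
        have := mul_le_mul_of_nonneg_left (e4.trans (by linarith :
          _ ≤ 6 * (l / (2 * Real.pi * s) ^ 3) ^ (1 / 4 : ℝ) + 2 + √(1 / s))) hinv.le
        linarith
    _ ≤ _ := by
        have h6 : 6 / s * (l / (2 * Real.pi * s) ^ 3) ^ (1 / 4 : ℝ) =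
          1 / s * (6 * (l / (2 * Real.pi * s) ^ 3) ^ (1 / 4 : ℝ)) := by ring
        have h20 : 20 / s = 20 * (1 / s) := by ring
        rw [h6, h20]
        nlinarith

end Walks

/-! ### The tracking bound. -/

theorem theorem1 {Ω : Type*} [MeasurableSpace Ω] (P : Measure Ω) [IsProbabilityMeasure P]
    (V W : ℕ → Ω → ℝ) (hV : ∀ i, Measurable (V i)) (hW : ∀ i, Measurable (W i))
    (hVlaw : ∀ i, HasLaw (V i) (gaussianReal 0 1) P)
    (hWlaw : ∀ i, HasLaw (W i) (gaussianReal 0 1) P)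
    (hindep : iIndepFun (Sum.elim V W) P)
    (ε s l : ℝ) (hε : 0 < ε) (hs : 0 < s) (hl : 0 < l)
    (τ η : Ω → WithTop ℕ)
    (hτ : τ = crossingTime (walkX s V) l)
    (hη : η = crossingTime (walkXhat ε s V W) l) :
    IsStoppingTime (filtrationY ε s hV hW) η ∧
    (∀ᵐ ω ∂P, τ ω ≠ ⊤) ∧
    (∀ᵐ ω ∂P, η ω ≠ ⊤) ∧
    Integrable (fun ω => |timeReal (η ω) - timeReal (τ ω)|) P ∧
    ∫ ω, |timeReal (η ω) - timeReal (τ ω)| ∂P ≤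
      √(2 * l * ε ^ 2 / (Real.pi * (1 + ε ^ 2) * s ^ 3))
        + 6 / s * (l / (2 * Real.pi * s) ^ 3) ^ (1 / 4 : ℝ)
        + √(8 * (s + 2) / (Real.pi * s ^ 3)) + 10 + 20 / s := by
  subst hτ hη
  have hr0 : (0 : ℝ) < 1 + ε ^ 2 := by positivity
  set w : NNReal := ⟨ε ^ 2 / (1 + ε ^ 2), by positivity⟩ with hwdef
  set vb : NNReal := ⟨1 / (1 + ε ^ 2), by positivity⟩ with hvbdef
  have hw : (w : ℝ) = ε ^ 2 / (1 + ε ^ 2) := rfl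
  have hvb : (vb : ℝ) = 1 / (1 + ε ^ 2) := rfl
  have hw1 : w ≤ 1 := by
    rw [← NNReal.coe_le_coe, hw, NNReal.coe_one, div_le_one hr0]
    linarith
  have hvb1 : vb ≤ 1 := by
    rw [← NNReal.coe_le_coe, hvb, NNReal.coe_one, div_le_one hr0]
    nlinarith
  have hvb0 : 0 < vb := by
    rw [← NNReal.coe_lt_coe, hvb]
    exact one_div_pos.2 hr0
  set a : ℕ → Ω → ℝ := fun i ω => s + (1 * V i ω + 0 * W i ω) with ha
  set b : ℕ → Ω → ℝ :=
    fun i ω => s + (1 / (1 + ε ^ 2) * V i ω + ε / (1 + ε ^ 2) * W i ω) with hb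
  have hinn := isGaussianInnovation_linear_combination hV hW hVlaw hWlaw hindep
  have ia : IsGaussianInnovation P (incrementFiltration hV hW) a s 1 :=
    hinn s 1 0 (by norm_num)
  have ib : IsGaussianInnovation P (incrementFiltration hV hW) b s vb :=
    hinn s _ _ (by rw [hvb]; field_simp)
  -- Both signs of the difference are needed, one for each order of the two crossings.
  have iba : IsGaussianInnovation P (incrementFiltration hV hW) (fun i ω => b i ω - a i ω) 0 w := by
    have h := hinn 0 (-(ε ^ 2 / (1 + ε ^ 2))) (ε / (1 + ε ^ 2)) (v := w)
      (by rw [hw]; field_simp; ring)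
    convert h using 3 with i ω
    simp only [ha, hb]; field_simp; ring
  have iab : IsGaussianInnovation P (incrementFiltration hV hW) (fun i ω => a i ω - b i ω) 0 w := by
    have h := hinn 0 (ε ^ 2 / (1 + ε ^ 2)) (-(ε / (1 + ε ^ 2))) (v := w)
      (by rw [hw]; field_simp; ring)
    convert h using 3 with i ω
    simp only [ha, hb]; field_simp; ring
  have hX : ∀ t ω, walkX s V t ω = ∑ i ∈ Finset.range t, a i ω := fun t ω => by
    simp [walkX, ha, Finset.sum_add_distrib]
    ring
  have hXh : ∀ t ω, walkXhat ε s V W t ω = ∑ i ∈ Finset.range t, b i ω := fun t ω => by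
    simp only [walkXhat, walkY, walkX, hb, Finset.sum_add_distrib, ← Finset.mul_sum,
      Finset.sum_const, Finset.card_range, nsmul_eq_mul]
    field_simp
    ring
  have eτ := staysBelow_eq_lt_crossingTime hX l
  have eη := staysBelow_eq_lt_crossingTime hXh l
  have hτ_top : ∀ᵐ ω ∂P, crossingTime (walkX s V) l ω ≠ ⊤ := by
    refine ae_ne_top_of_sum_prob_le (C := (l + (s + 1)) / s) fun n => ?_
    simp_rw [← eτ]
    rw [le_div_iff₀' hs]
    exact ia.mul_sum_prob_staysBelow_le hs.le hl.le one_pos le_rfl n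
  have hη_top : ∀ᵐ ω ∂P, crossingTime (walkXhat ε s V W) l ω ≠ ⊤ := by
    refine ae_ne_top_of_sum_prob_le (C := (l + (s + 1)) / s) fun n => ?_
    simp_rw [← eη]
    rw [le_div_iff₀' hs]
    exact ib.mul_sum_prob_staysBelow_le hs.le hl.le hvb0 hvb1 n
  refine ⟨?_, hτ_top, hη_top, ?_⟩
  -- The stopping property needs the filtration of `Y` itself: the estimate at time `t` is an affine
  -- function of `Y_t`. The moment bounds use the larger filtration generated by all increments, to
  -- which both walks are adapted.
  · refine Adapted.isStoppingTime_hittingAfter (fun t => ?_) measurableSet_Ici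
    have hY : Measurable[filtrationY ε s hV hW t] (walkY ε s V W t) :=
      (Filtration.stronglyAdapted_natural (stronglyMeasurable_walkY ε s hV hW) t).measurable
    exact ((hY.sub_const _).const_mul _).const_add _
  -- The bound for one order of crossing is the same as for the other, hence the factor `2 / s`.
  · have hmain : ∀ n, ∑ t ∈ Finset.range n,
        (P.real ((staysBelow b l t)ᶜ ∩ staysBelow a l t) +
          P.real ((staysBelow a l t)ᶜ ∩ staysBelow b l t)) ≤
        2 / s * (√(l / s * (ε ^ 2 / (1 + ε ^ 2))) / √(2 * Real.pi)
          + 1 / 2 * √(√(l / s) / s + 2 + 1 / s) + (s + 1)) := fun n => by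
      have h1 := ia.mul_sum_prob_between_le ib iba hs hl one_pos le_rfl hvb0 hvb1 hw1 n
      have h2 := ib.mul_sum_prob_between_le ia iab hs hl hvb0 hvb1 one_pos le_rfl hw1 n
      rw [hw] at h1 h2
      rw [Finset.sum_add_distrib, div_mul_eq_mul_div, le_div_iff₀' hs]
      linarith
    simp_rw [eτ, eη] at hmain
    have hmeas := fun (t : ℕ) => (incrementFiltration hV hW).le t _ (ia.measurableSet_staysBelow l t)
    have hmeas' := fun (t : ℕ) => (incrementFiltration hV hW).le t _ (ib.measurableSet_staysBelow l t)
    rw [funext eτ] at hmeas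
    rw [funext eη] at hmeas'
    obtain ⟨h1, h2⟩ := integral_abs_timeReal_sub_le hmeas' hmeas hη_top hτ_top hmain
    exact ⟨h1, h2.trans (tracking_constant_le hs hl)⟩
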